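/- Let $G=(V,E)$ be a finite connected graph with at least one edge (loops and multiple edges allowed), cellularly embedded in a closed connected oriented surface $\Sigma$ of genus $g\ge 0$ (all faces are open discs; up to homeomorphism such an embedding is the same thing as a combinatorial map, i.e. a rotation system on the finite set of oriented edges of $G$). Let $G^*=(V^*,E^*)$ be the dual graph, $e\leftrightarrow e^*$ the bijection of primal and dual edges, and let $(J_{e^*})_{e^*\in E^*}$ be positive coupling constants. *Polygon configurations.* A polygon configuration of $G$ is a set of edges in which every vertex has even degree. For $\varepsilon\in H_1(\Sigma;\mathbb Z/2\mathbb Z)$ let $\mathcal P^{\varepsilon}(G)$ be the set of polygon configurations of homology class $\varepsilon$. For each $\varepsilon$ fix an arbitrary representative $\underline\varepsilon\in\mathcal P^{\varepsilon}(G)$. *Double Ising model.* Let $Z^{\varepsilon}_{\mathrm{Ising}}(G^*,J)=\sum_{\sigma\in\{\pm1\}^{V^*}}\exp\bigl(\sum_{e^*=u^*v^*}\pm J_{e^*}\sigma_{u^*}\sigma_{v^*}\bigr)$, with sign $-$ if $e\in\underline\varepsilon$ and $+$ otherwise. The double Ising model is the probability measure $\mathbb P_{\mathrm{dIsing}}$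 on $\bigcup_{\varepsilon}\mathcal P^{\varepsilon}(G)\times\mathcal P^{\varepsilon}(G)$ that gives $(P_{\mathrm{red}},P_{\mathrm{blue}})$ a probability proportional to the weight $$\Bigl(2\prod_{e\in E}e^{J_{e^*}}\Bigr)^2\prod_{e\in P_{\mathrm{red}}}e^{-2J_{e^*}}\prod_{e\in P_{\mathrm{blue}}}e^{-2J_{e^*}},$$ and $Z_{\mathrm{dIsing}}(G^*,J)$ is the sum of these weights over $\bigcup_{\varepsilon}\mathcal P^{\varepsilon}(G)\times\mathcal P^{\varepsilon}(G)$. For a pair $(P_{\mathrm{red}},P_{\mathrm{blue}})$ of class $\varepsilon$ choose spin configurations $\sigma,\sigma'$ on $V^*$ such that $P_{\mathrm{red}}$ (resp. $P_{\mathrm{blue}}$) is obtained from the set of edges separating distinct spins of $\sigma$ (resp. $\sigma'$) by switching the state of every edge of $\underline\varepsilon$; then $\mathrm{XOR}(P_{\mathrm{red}},P_{\mathrm{blue}})$ is the set of edges $e$ such that the product $\sigma\sigma'$ takes distinct values at the two ends of $e^*$. *Dimer model.* The medial graph has one vertex in the middle of each edge of $G$ and one edge for each corner of $G$ (a corner is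 a pair of consecutive edge-ends around a vertex), joining the middles of the two edges that bound the corner; it is $4$-regular. The bipartite graph $G^Q$ is obtained by replacing each medial vertex by a quadrangle, each of whose four vertices is attached to one of the four medial edge-ends there. The medial (external) edges have weight $1$; in the quadrangle at $e$, the two sides parallel to $e$ have weight $a_e$ and the two sides parallel to $e^*$ have weight $b_{e^*}$, where $$a_e=\frac{2e^{-2J_{e^*}}}{1+e^{-4J_{e^*}}},\qquad b_{e^*}=\frac{1-e^{-4J_{e^*}}}{1+e^{-4J_{e^*}}}.$$ For a dimer configuration (perfect matching) $M$ of $G^Q$, $\mathrm{poly}_1(M)$ is the set of edges $e$ of $G$ such that, at the middle of $e$, the two medial edges on one side of $e$ are both in $M$ and the two on the other side are both not in $M$. Let $\mathcal M^0(G^Q)$ be the set of dimer configurations $M$ with $\mathrm{poly}_1(M)\in\mathcal P^0(G)$, let $Z^0_Q(G^Q,J)$ be the sum over $M\in\mathcal M^0(G^Q)$ of the product of the weights of the edges of $M$, and let $\mathbb P^0_Q$ be the corresponding probability measure on $\mathcal M^0(G^Q)$. **Theorem.** One has $$Z_{\mathrm{dIsing}}(G^*,J)=\sum_{\varepsilon\in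 H_1(\Sigma;\mathbb Z/2\mathbb Z)}\bigl(Z^{\varepsilon}_{\mathrm{Ising}}(G^*,J)\bigr)^2=2^{|V^*|+2g}\Bigl(\prod_{e\in E}\cosh(2J_{e^*})\Bigr)Z^0_Q(G^Q,J),$$ and for every $P\in\mathcal P^0(G)$, $$\mathbb P_{\mathrm{dIsing}}[\mathrm{XOR}=P]=\mathbb P^0_Q[\mathrm{poly}_1=P].$$ -/

import Mathlib

/-- A finite connected graph cellularly embedded in a closed connected oriented surface, up to
orientation preserving homeomorphism, given as a combinatorial map (rotation system) on the finite
set `D` of darts, a dart being an edge together with one of its two orientations. Loops and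
multiple edges are allowed. -/
structure SurfaceMap (D : Type*) where
  /-- The next dart counterclockwise around the source of a dart. -/
  rot : Equiv.Perm D
  /-- Reversal of a dart. -/
  rev : Equiv.Perm D
  rev_rev : ∀ d, rev (rev d) = d
  rev_ne : ∀ d, rev d ≠ d
  connected : ∀ d d' : D, ∃ p ∈ Subgroup.closure {rot, rev}, p d = d'

namespace SurfaceMap

variable {D : Type*} (M : SurfaceMap D)

/-- The next dart along the boundary of the face lying to the left of a dart. -/
def nextInFace : Equiv.Perm D := M.rot⁻¹ * M.rev

/-- The vertices of `G`: orbits of the rotation. -/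
def Vertex : Type _ := Quotient (Equiv.Perm.SameCycle.setoid M.rot)

/-- The edges of `G`: pairs `{d, rev d}`. They also index the edges of the dual graph. -/
def Edge : Type _ := Quotient (Equiv.Perm.SameCycle.setoid M.rev)

/-- The faces of `G`, which are the vertices of the dual graph. -/
def Face : Type _ := Quotient (Equiv.Perm.SameCycle.setoid M.nextInFace)

/-- The source of a dart. -/
def vertex (d : D) : M.Vertex := Quotient.mk _ d

/-- The edge carrying a dart. -/
def edge (d : D) : M.Edge := Quotient.mk _ d

/-- The face to the left of a dart. The dual of the edge of `d` joins the dual vertices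
`M.face d` and `M.face (M.rev d)`. -/
def face (d : D) : M.Face := Quotient.mk _ d

instance [Finite D] : Finite M.Vertex := inferInstanceAs (Finite (Quotient _))
instance [Finite D] : Finite M.Edge := inferInstanceAs (Finite (Quotient _))
instance [Finite D] : Finite M.Face := inferInstanceAs (Finite (Quotient _))

noncomputable instance [Finite D] : Fintype M.Vertex := Fintype.ofFinite _
noncomputable instance [Finite D] : Fintype M.Edge := Fintype.ofFinite _
noncomputable instance [Finite D] : Fintype M.Face := Fintype.ofFinite _
noncomputable instance : DecidableEq M.Vertex := Classical.decEq _
noncomputable instance : DecidableEq M.Edge := Classical.decEq _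
noncomputable instance : DecidableEq M.Face := Classical.decEq _

variable [Fintype D]

/-- The surface has genus `g`: its Euler characteristic `|V| - |E| + |F|` is `2 - 2g`. -/
def HasGenus (g : ℕ) : Prop :=
  (Fintype.card M.Vertex : ℤ) - Fintype.card M.Edge + Fintype.card M.Face = 2 - 2 * g

/-! ### Cellular homology modulo 2 and polygon configurations -/

/-- The boundary of a 1-chain with coefficients in `ℤ/2`. -/
noncomputable def boundary₁ : (M.Edge → ZMod 2) →ₗ[ZMod 2] (M.Vertex → ZMod 2) where
  toFun c v := ∑ d with M.vertex d = v, c (M.edge d)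
  map_add' c c' := by ext v; simp [Finset.sum_add_distrib]
  map_smul' r c := by ext v; simp [Finset.mul_sum]

/-- The boundary of a 2-chain with coefficients in `ℤ/2`. -/
noncomputable def boundary₂ : (M.Face → ZMod 2) →ₗ[ZMod 2] (M.Edge → ZMod 2) where
  toFun A e := ∑ d with M.edge d = e, A (M.face d)
  map_add' c c' := by ext v; simp [Finset.sum_add_distrib]
  map_smul' r c := by ext v; simp [Finset.mul_sum]

/-- The first homology group `H₁(Σ; ℤ/2)`: cycles modulo boundaries. -/
abbrev H₁ : Type _ :=
  LinearMap.ker M.boundary₁ ⧸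
    (LinearMap.range M.boundary₂).comap (LinearMap.ker M.boundary₁).subtype

noncomputable instance : Fintype M.H₁ :=
  haveI : Finite M.H₁ := inferInstanceAs (Finite (Quotient _))
  Fintype.ofFinite _

/-- The 1-chain of a set of edges. -/
noncomputable def chain (P : Finset M.Edge) : M.Edge → ZMod 2 := fun e => if e ∈ P then 1 else 0

/-- A polygon configuration of `G`: a set of edges such that every vertex has even degree in it
(a loop counts twice in the degree). -/
def IsPolygon (P : Finset M.Edge) : Prop :=
  ∀ v, Even (Finset.card {d : D | M.vertex d = v ∧ M.edge d ∈ P})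

theorem IsPolygon.boundary_eq_zero {M : SurfaceMap D} {P : Finset M.Edge} (h : M.IsPolygon P) :
    M.chain P ∈ LinearMap.ker M.boundary₁ := by
  rw [LinearMap.mem_ker]
  ext v
  have := h v
  simp only [boundary₁, chain, LinearMap.coe_mk, AddHom.coe_mk, Pi.zero_apply, Finset.sum_boole,
    Finset.filter_filter]
  exact (ZMod.natCast_eq_zero_iff_even).2 this

/-- The homology class of a polygon configuration. -/
noncomputable def homologyClass (P : Finset M.Edge) (h : M.IsPolygon P) : M.H₁ :=
  Submodule.Quotient.mk ⟨M.chain P, h.boundary_eq_zero⟩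

open scoped Classical in
/-- The set `𝒫^ε(G)` of polygon configurations of `G` with homology class `ε`. -/
noncomputable def polygons (ε : M.H₁) : Finset (Finset M.Edge) :=
  {P | ∃ h : M.IsPolygon P, M.homologyClass P h = ε}

/-! ### The Ising model on the dual graph, with defects -/

/-- Spin configurations on the vertices of the dual graph. -/
abbrev Spins : Type _ := M.Face → ℤˣ

/-- The product of the two spins at the ends of the dual edge of `e`. -/
noncomputable def bond (s : M.Spins) (e : M.Edge) : ℤˣ := ∏ d with M.edge d = e, s (M.face d)

/-- The Ising partition function on the dual graph with coupling constants `J`, negated on the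
dual edges that cross `c`. -/
noncomputable def isingZ (J : M.Edge → ℝ) (c : Finset M.Edge) : ℝ :=
  ∑ s : M.Spins, Real.exp (∑ e, (if e ∈ c then -J e else J e) * ((M.bond s e : ℤ) : ℝ))

open scoped Classical in
/-- The edges of `G` that separate clusters of equal spins: those whose dual edge has distinct
spins at its ends. -/
noncomputable def domainWall (s : M.Spins) : Finset M.Edge :=
  {e | ∃ d, M.edge d = e ∧ s (M.face d) ≠ s (M.face (M.rev d))}

/-- The low-temperature expansion of a spin configuration of the Ising model with defect line
`c`: the domain wall, with the state of every edge of `c` switched. -/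
noncomputable def lowTemp (c : Finset M.Edge) (s : M.Spins) : Finset M.Edge :=
  symmDiff (M.domainWall s) c

/-! ### The double Ising model -/

open scoped Classical in
/-- The sample space of the double Ising model: pairs of polygon configurations with the same
homology class. -/
noncomputable def dIsingConfigs : Finset (Finset M.Edge × Finset M.Edge) :=
  {Q | ∃ ε : M.H₁, Q.1 ∈ M.polygons ε ∧ Q.2 ∈ M.polygons ε}

/-- The weight of a pair `(P_red, P_blue)`. -/
noncomputable def dIsingWeight (J : M.Edge → ℝ) (Q : Finset M.Edge × Finset M.Edge) : ℝ :=
  (2 * ∏ e, Real.exp (J e)) ^ 2 * (∏ e ∈ Q.1, Real.exp (-2 * J e)) *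
    ∏ e ∈ Q.2, Real.exp (-2 * J e)

/-- The double Ising partition function. -/
noncomputable def dIsingZ (J : M.Edge → ℝ) : ℝ :=
  ∑ ε : M.H₁, ∑ Q ∈ M.polygons ε ×ˢ M.polygons ε, M.dIsingWeight J Q

/-- `P` is the XOR loop configuration of `(P_red, P_blue)`: if `(s, s')` is a pair of spin
configurations with the same defect line (the representative `rep ε` of a homology class `ε`)
whose low-temperature expansions are `P_red` and `P_blue`, then `P` separates the clusters of
the XOR-spins `s * s'`. -/
def IsXOR (rep : M.H₁ → Finset M.Edge) (Q : Finset M.Edge × Finset M.Edge)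
    (P : Finset M.Edge) : Prop :=
  ∃ (ε : M.H₁) (s s' : M.Spins), M.lowTemp (rep ε) s = Q.1 ∧ M.lowTemp (rep ε) s' = Q.2 ∧
    M.domainWall (s * s') = P

open scoped Classical in
/-- The probability under the double Ising measure that the XOR loop configuration is `P`. -/
noncomputable def dIsingProbXOR (rep : M.H₁ → Finset M.Edge) (J : M.Edge → ℝ)
    (P : Finset M.Edge) : ℝ :=
  ∑ Q ∈ M.dIsingConfigs with M.IsXOR rep Q P, M.dIsingWeight J Q / M.dIsingZ J

/-! ### The quadri-tiling graph and its dimer model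

The medial graph has one vertex in the middle of each edge of `G` and one edge for each corner of
`G`; the corner between `d` and `rot d` is indexed by `d`. Around the middle of the edge of `d`,
the four corners are, in cyclic order: `d` (left of `d`, at its source), `rot⁻¹ d` (right, source),
`rev d` (right, target) and `nextInFace d = rot⁻¹ (rev d)` (left, target). The quadri-tiling graph
replaces each medial vertex by a quadrangle with one vertex for each of its four corners. -/

/-- The vertices of the quadri-tiling graph: `(d, true)` and `(d, false)` are the vertices of the
quadrangle at the edge of `d` that lie near the source of `d`, respectively to the left and to the
right of `d`. This is the bipartition of the graph. -/
abbrev QVertex (_M : SurfaceMap D) : Type _ := D × Bool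

/-- The kinds of edges of the quadri-tiling graph: external edges (those of the medial graph), and
internal ones, parallel to an edge of `G` or to a dual edge. -/
inductive QKind : Type
  | external
  | primal
  | dual

/-- The edges of the quadri-tiling graph. Among them, `(external, d)` is the medial edge at the
corner `d`, `(primal, d)` runs along the left side of `d`, and `(dual, d)` is parallel to the dual
edge, near the source of `d`. -/
abbrev QEdge (_M : SurfaceMap D) : Type _ := QKind × D

instance : Finite QKind :=
  Finite.of_injective (fun k : QKind => QKind.casesOn (motive := fun _ => Fin 3) k 0 1 2) (by
    intro a b h; cases a <;> cases b <;> simp_all)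

noncomputable instance : Fintype QKind := Fintype.ofFinite _

/-- The end in the class `true` of the bipartition is `(d, true)`; this is the other end. -/
def otherEnd : M.QEdge → M.QVertex
  | (QKind.external, d) => (M.rot d, false)
  | (QKind.primal, d) => (M.rev d, false)
  | (QKind.dual, d) => (d, false)

/-- The two ends of an edge of the quadri-tiling graph. -/
def IsEnd (x : M.QVertex) (q : M.QEdge) : Prop := x = (q.2, true) ∨ x = M.otherEnd q

/-- Dimer configurations: every vertex is an end of exactly one edge. -/
def IsDimer (X : Finset M.QEdge) : Prop := ∀ x : M.QVertex, ∃! q, q ∈ X ∧ M.IsEnd x q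

/-- The edge weights induced by weights `a` of the edges of `G` and `b` of the dual edges. -/
def qWeight (a b : M.Edge → ℝ) : M.QEdge → ℝ
  | (QKind.external, _) => 1
  | (QKind.primal, d) => a (M.edge d)
  | (QKind.dual, d) => b (M.edge d)

/-- The 6-vertex configuration of a set of edges of the quadri-tiling graph: the medial edges
(corners) that it contains. -/
def sixVertex (X : Finset M.QEdge) : Set D := {d | (QKind.external, d) ∈ X}

open scoped Classical in
/-- The edges of `G` that separate two neighbouring present from two neighbouring absent medial
edges in a 6-vertex configuration `c`: at the edge of `d`, the two corners to the left of `d` are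
in the same state, the two to the right are in the same state, and these states differ. -/
noncomputable def primalContour (c : Set D) : Finset M.Edge :=
  {e | ∃ d, M.edge d = e ∧ (d ∈ c ↔ M.nextInFace d ∈ c) ∧ (M.rot⁻¹ d ∈ c ↔ M.rev d ∈ c) ∧
    ¬(d ∈ c ↔ M.rot⁻¹ d ∈ c)}

/-- The primal polygon configuration of a dimer configuration. -/
noncomputable def poly₁ (X : Finset M.QEdge) : Finset M.Edge := M.primalContour (M.sixVertex X)

open scoped Classical in
/-- Dimer configurations whose primal polygon configuration has homology class `0`. -/
noncomputable def dimers₀ : Finset (Finset M.QEdge) :=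
  {X | M.IsDimer X ∧ M.poly₁ X ∈ M.polygons 0}

/-- The homology-restricted dimer partition function. -/
noncomputable def dimerZ₀ (a b : M.Edge → ℝ) : ℝ :=
  ∑ X ∈ M.dimers₀, ∏ q ∈ X, M.qWeight a b q

/-- The probability that `poly₁ = P` under the homology-restricted dimer measure. -/
noncomputable def dimerProbPoly₁ (a b : M.Edge → ℝ) (P : Finset M.Edge) : ℝ :=
  ∑ X ∈ M.dimers₀ with M.poly₁ X = P, (∏ q ∈ X, M.qWeight a b q) / M.dimerZ₀ a b

/-- The weights of internal edges parallel to edges of `G`. -/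
noncomputable def aWeight (J : M.Edge → ℝ) (e : M.Edge) : ℝ :=
  2 * Real.exp (-2 * J e) / (1 + Real.exp (-4 * J e))

/-- The weights of internal edges parallel to dual edges. -/
noncomputable def bWeight (J : M.Edge → ℝ) (e : M.Edge) : ℝ :=
  (1 - Real.exp (-4 * J e)) / (1 + Real.exp (-4 * J e))

end SurfaceMap

/-!
The identity of partition functions holds separately for every XOR loop configuration `P`, a
domain wall of face spins; summing over `P` gives the second equality, and dividing by the sum
gives the equality of probability measures.

On the Ising side, two polygon configurations have the same class exactly when their symmetric
difference is a domain wall, and that difference is the XOR configuration (`isXOR_iff`). Thus the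
pairs with XOR configuration `P` are the pairs `(Q, Q ∆ P)` with `Q` any polygon configuration, and
their weight is a product over the edges (`dIsingWeight_symmDiff`). The evenness of the degrees of
`Q` is detected by a sum over spins `r` on the vertices of `G`, which leaves a free sum over `Q`.
The factor of an edge in `P` becomes `1` if `r` agrees at its two ends and `0` otherwise; outside
`P` it becomes `cosh` or `sinh` of `2J`. All factors being divided by `cosh (2J)`, this is a sum
over `r` of products of the weights `a` on `P` and `b` on the edges along which `r` changes, with
the restriction that no edge is in both sets (`sum_dIsingWeight_symmDiff`). The powers of `2`
combine through Euler's formula.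

On the dimer side, a perfect matching is an assignment of a kind of edge to every dart; given its
external edges it decouples into matchings of the single quadrangles, and `a² + b² = 1` turns the
sum over these into a free-fermionic 6-vertex weight (`sum_kinds_eq_prod_localWeight`). A 6-vertex
configuration whose primal contour is the domain wall of `s` changes along the rotation at a vertex
exactly when `s` does, so it is the configuration of the corners where `s` agrees with a spin
configuration `r` on the vertices, and `r` is unique (`exists_spinCorners_eq`). The result is the
same sum over `r` (`sum_dimers₀_eq_sum_mixedWeight`).

The first equality is the low-temperature expansion: since the dual graph is connected, each
polygon configuration comes from exactly two spin configurations (`sum_lowTemp`).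
-/

namespace SurfaceMap

section

variable {D : Type*} (M : SurfaceMap D)

/-! ### Darts, edges, faces and vertices -/

theorem edge_rev (d : D) : M.edge (M.rev d) = M.edge d :=
  Quotient.sound ⟨1, by simp [M.rev_rev]⟩

theorem edge_eq_iff {d d' : D} : M.edge d' = M.edge d ↔ d' = d ∨ d' = M.rev d := by
  constructor
  · intro h
    obtain ⟨i, hi⟩ : M.rev.SameCycle d d' := Quotient.exact h.symm
    have h2 : M.rev * M.rev = 1 := Equiv.ext M.rev_rev
    rcases Int.even_or_odd' i with ⟨k, rfl | rfl⟩
    · left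
      rw [zpow_mul, zpow_two, h2, one_zpow] at hi
      exact hi.symm
    · right
      rw [zpow_add, zpow_mul, zpow_two, h2, one_zpow] at hi
      simpa using hi.symm
  · rintro (rfl | rfl)
    · rfl
    · exact M.edge_rev d

theorem edge_surjective : Function.Surjective M.edge := Quotient.mk_surjective

/-- A chosen orientation of an edge. -/
noncomputable def outDart (e : M.Edge) : D := Function.surjInv M.edge_surjective e

theorem edge_outDart (e : M.Edge) : M.edge (M.outDart e) = e :=
  Function.surjInv_eq M.edge_surjective e

theorem vertex_surjective : Function.Surjective M.vertex := Quotient.mk_surjective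

theorem face_surjective : Function.Surjective M.face := Quotient.mk_surjective

theorem face_nextInFace (d : D) : M.face (M.nextInFace d) = M.face d :=
  (Quotient.sound ⟨1, by simp⟩ : M.face d = M.face (M.nextInFace d)).symm

theorem vertex_rot (d : D) : M.vertex (M.rot d) = M.vertex d :=
  (Quotient.sound ⟨1, by simp⟩ : M.vertex d = M.vertex (M.rot d)).symm

theorem vertex_rot_inv (d : D) : M.vertex (M.rot⁻¹ d) = M.vertex d := by
  rw [← M.vertex_rot (M.rot⁻¹ d)]; simp

/-- The corner clockwise from `d` lies in the face to the right of `d`. -/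
theorem face_rot_inv (d : D) : M.face (M.rot⁻¹ d) = M.face (M.rev d) := by
  rw [← M.face_nextInFace (M.rev d)]; simp [nextInFace, M.rev_rev]

/-- The dual graph is connected: a function on faces that agrees across every edge is constant. -/
theorem face_fun_const {α : Type*} {f : M.Face → α}
    (h : ∀ d, f (M.face d) = f (M.face (M.rev d))) (x y : M.Face) : f x = f y := by
  obtain ⟨d, rfl⟩ := M.face_surjective x
  obtain ⟨d', rfl⟩ := M.face_surjective y
  obtain ⟨p, hp, rfl⟩ := M.connected d d'
  suffices H : ∀ d, f (M.face d) = f (M.face (p d)) from H d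
  induction hp using Subgroup.closure_induction with
  | mem p hp =>
    rcases hp with rfl | rfl
    · intro d
      have := h (M.rot d)
      rw [← M.face_rot_inv] at this
      simpa using this.symm
    · exact h
  | one => intro d; rfl
  | mul p q _ _ hp hq => intro d; rw [hq d, hp (q d)]; rfl
  | inv p _ hp => intro d; rw [hp (p⁻¹ d)]; simp

theorem chain_injective : Function.Injective M.chain := by
  intro P Q h
  ext e
  have := congrFun h e
  by_cases h1 : e ∈ P <;> by_cases h2 : e ∈ Q <;> simp_all [chain]

theorem chain_symmDiff (P Q : Finset M.Edge) :
    M.chain (symmDiff P Q) = M.chain P + M.chain Q := by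
  ext e
  by_cases h1 : e ∈ P <;> by_cases h2 : e ∈ Q <;>
    simp [chain, Finset.mem_symmDiff, h1, h2, CharTwo.add_self_eq_zero]

/-- The 2-chain of the faces with spin `-1`. -/
def minusChain (s : M.Spins) : M.Face → ZMod 2 := fun f => if s f = 1 then 0 else 1

theorem minusChain_surjective : Function.Surjective M.minusChain := by
  intro A
  refine ⟨fun f => if A f = 0 then 1 else -1, funext fun f => ?_⟩
  by_cases h : A f = 0
  · simp [minusChain, h]
  · have : A f = 1 := (by decide : ∀ x : ZMod 2, x ≠ 0 → x = 1) _ h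
    simp [minusChain, this]

variable [Fintype D]

@[to_additive]
theorem prod_edge_fiber {β : Type*} [CommMonoid β] (f : D → β) (d : D) :
    ∏ d' with M.edge d' = M.edge d, f d' = f d * f (M.rev d) := by
  classical
  rw [← Finset.prod_pair (M.rev_ne d).symm]
  refine Finset.prod_congr ?_ fun _ _ => rfl
  ext d'
  simp [M.edge_eq_iff]

theorem boundary₂_edge (A : M.Face → ZMod 2) (d : D) :
    M.boundary₂ A (M.edge d) = A (M.face d) + A (M.face (M.rev d)) :=
  M.sum_edge_fiber (fun d => A (M.face d)) d

theorem boundary₁_boundary₂ (A : M.Face → ZMod 2) : M.boundary₁ (M.boundary₂ A) = 0 := by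
  ext v
  have h : M.boundary₁ (M.boundary₂ A) v =
      ∑ d with M.vertex d = v, (A (M.face d) + A (M.face (M.rot⁻¹ d))) :=
    Finset.sum_congr rfl fun d _ => by rw [M.boundary₂_edge, M.face_rot_inv]
  -- the face to the right of `d` is to the left of `rot⁻¹ d`, so the two terms have equal sums
  have h' : ∑ d with M.vertex d = v, A (M.face (M.rot⁻¹ d)) =
      ∑ d with M.vertex d = v, A (M.face d) :=
    Finset.sum_equiv M.rot⁻¹ (fun d => by
      rw [Finset.mem_filter_univ, Finset.mem_filter_univ, M.vertex_rot_inv]) fun _ _ => rfl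
  rw [h, Finset.sum_add_distrib, h']
  exact CharTwo.add_self_eq_zero _

/-! ### Polygon configurations and domain walls -/

variable {M}

theorem isPolygon_iff {P : Finset M.Edge} : M.IsPolygon P ↔ M.boundary₁ (M.chain P) = 0 := by
  refine ⟨fun h => h.boundary_eq_zero, fun h v => ?_⟩
  have := congrFun h v
  simp only [boundary₁, chain, LinearMap.coe_mk, AddHom.coe_mk, Pi.zero_apply, Finset.sum_boole,
    Finset.filter_filter] at this
  exact (ZMod.natCast_eq_zero_iff_even).1 this

variable (M)

theorem edge_mem_domainWall (s : M.Spins) (d : D) :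
    M.edge d ∈ M.domainWall s ↔ s (M.face d) ≠ s (M.face (M.rev d)) := by
  simp only [domainWall, Finset.mem_filter, Finset.mem_univ, true_and, M.edge_eq_iff]
  constructor
  · rintro ⟨d', rfl | rfl, h⟩
    · exact h
    · rw [M.rev_rev] at h; exact h.symm
  · exact fun h => ⟨d, Or.inl rfl, h⟩

theorem chain_domainWall (s : M.Spins) :
    M.chain (M.domainWall s) = M.boundary₂ (M.minusChain s) := by
  ext e
  obtain ⟨d, rfl⟩ := M.edge_surjective e
  rw [M.boundary₂_edge]
  simp only [chain, M.edge_mem_domainWall]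
  rcases Int.units_eq_one_or (s (M.face d)) with h | h <;>
    rcases Int.units_eq_one_or (s (M.face (M.rev d))) with h' | h' <;>
    simp [minusChain, h, h', CharTwo.add_self_eq_zero]

variable {M}

/-- The low-temperature expansions with defect line `c` are the polygon configurations homologous
to `c`. -/
theorem exists_lowTemp_eq_iff {c P : Finset M.Edge} {ε : M.H₁} (hc : c ∈ M.polygons ε) :
    (∃ s, M.lowTemp c s = P) ↔ P ∈ M.polygons ε := by
  simp only [polygons, Finset.mem_filter, Finset.mem_univ, true_and] at hc ⊢
  obtain ⟨hc, rfl⟩ := hc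
  have key : ∀ hP : M.IsPolygon P, M.homologyClass P hP = M.homologyClass c hc ↔
      ∃ A, M.boundary₂ A = M.chain P - M.chain c := fun hP => by
    rw [homologyClass, homologyClass, Submodule.Quotient.eq]
    rfl
  have hlow : ∀ s, M.lowTemp c s = P ↔
      M.boundary₂ (M.minusChain s) = M.chain P - M.chain c := fun s => by
    rw [← M.chain_injective.eq_iff, lowTemp, M.chain_symmDiff, M.chain_domainWall,
      eq_sub_iff_add_eq]
  simp only [hlow]
  constructor
  · rintro ⟨s, hs⟩
    have hP : M.IsPolygon P := by
      rw [isPolygon_iff, ← sub_add_cancel (M.chain P) (M.chain c), ← hs, map_add,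
        M.boundary₁_boundary₂, isPolygon_iff.1 hc, add_zero]
    exact ⟨hP, (key hP).2 ⟨_, hs⟩⟩
  · rintro ⟨hP, h⟩
    obtain ⟨A, hA⟩ := (key hP).1 h
    obtain ⟨s, rfl⟩ := M.minusChain_surjective A
    exact ⟨s, hA⟩

theorem empty_mem_polygons_zero : (∅ : Finset M.Edge) ∈ M.polygons 0 := by
  have h0 : M.chain ∅ = 0 := by ext e; simp [chain]
  have h : M.IsPolygon ∅ := by rw [isPolygon_iff, h0, map_zero]
  simp only [polygons, Finset.mem_filter, Finset.mem_univ, true_and]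
  refine ⟨h, ?_⟩
  rw [homologyClass, Submodule.Quotient.mk_eq_zero]
  change M.chain ∅ ∈ LinearMap.range M.boundary₂
  rw [h0]
  exact zero_mem _

theorem mem_polygons_zero {P : Finset M.Edge} :
    P ∈ M.polygons 0 ↔ ∃ s, M.domainWall s = P := by
  rw [← exists_lowTemp_eq_iff empty_mem_polygons_zero]
  simp [lowTemp, ← Finset.bot_eq_empty]

theorem IsPolygon.mem_polygons {P : Finset M.Edge} (h : M.IsPolygon P) :
    P ∈ M.polygons (M.homologyClass P h) := by
  simp only [polygons, Finset.mem_filter, Finset.mem_univ, true_and]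
  exact ⟨h, trivial⟩

theorem isPolygon_of_mem {P : Finset M.Edge} {ε : M.H₁} (h : P ∈ M.polygons ε) :
    M.IsPolygon P := by
  simp only [polygons, Finset.mem_filter, Finset.mem_univ, true_and] at h
  exact h.1

theorem eq_of_mem_polygons {P : Finset M.Edge} {ε ε' : M.H₁} (h : P ∈ M.polygons ε)
    (h' : P ∈ M.polygons ε') : ε = ε' := by
  simp only [polygons, Finset.mem_filter, Finset.mem_univ, true_and] at h h'
  obtain ⟨_, rfl⟩ := h
  obtain ⟨_, rfl⟩ := h'
  rfl

/-- Two polygon configurations are homologous when their symmetric difference is a boundary. -/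
theorem symmDiff_mem_polygons_zero_iff {P Q : Finset M.Edge} {ε : M.H₁} (hP : P ∈ M.polygons ε) :
    symmDiff P Q ∈ M.polygons 0 ↔ Q ∈ M.polygons ε := by
  rw [mem_polygons_zero, ← exists_lowTemp_eq_iff hP]
  refine exists_congr fun s => ?_
  rw [lowTemp]
  constructor
  · intro h
    rw [h, symmDiff_comm P Q, symmDiff_symmDiff_cancel_right]
  · rintro rfl
    rw [symmDiff_comm, symmDiff_symmDiff_cancel_right]

theorem domainWall_mul (s s' : M.Spins) :
    M.domainWall (s * s') = symmDiff (M.domainWall s) (M.domainWall s') := by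
  ext e
  obtain ⟨d, rfl⟩ := M.edge_surjective e
  simp only [Finset.mem_symmDiff, M.edge_mem_domainWall, Pi.mul_apply]
  generalize s (M.face d) = a, s (M.face (M.rev d)) = b, s' (M.face d) = a',
    s' (M.face (M.rev d)) = b'
  revert a b a' b'
  decide

theorem domainWall_eq_empty_iff [Nonempty D] {s : M.Spins} :
    M.domainWall s = ∅ ↔ s = 1 ∨ s = -1 := by
  constructor
  · intro h
    have hs : ∀ d, s (M.face d) = s (M.face (M.rev d)) := fun d => by
      by_contra hd
      have := (M.edge_mem_domainWall s d).2 hd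
      simp [h] at this
    have hc := M.face_fun_const hs
    obtain ⟨d⟩ := ‹Nonempty D›
    rcases Int.units_eq_one_or (s (M.face d)) with h | h
    · exact Or.inl (funext fun f => (hc f _).trans h)
    · exact Or.inr (funext fun f => (hc f _).trans h)
  · rintro (rfl | rfl) <;> ext e <;> obtain ⟨d, rfl⟩ := M.edge_surjective e <;>
      simp [M.edge_mem_domainWall]

theorem domainWall_eq_iff [Nonempty D] {s s' : M.Spins} :
    M.domainWall s' = M.domainWall s ↔ s' = s ∨ s' = -s := by
  rw [← symmDiff_eq_bot, ← domainWall_mul, Finset.bot_eq_empty, domainWall_eq_empty_iff]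
  have hs : s * s = 1 := funext fun f => Int.units_mul_self (s f)
  constructor
  · rintro (h | h)
    · left; rw [← mul_one s', ← hs, ← mul_assoc, h, one_mul]
    · right; rw [← mul_one s', ← hs, ← mul_assoc, h, neg_one_mul]
  · rintro (rfl | rfl)
    · exact Or.inl hs
    · right; rw [neg_mul, hs]

/-! ### The low-temperature expansion -/

theorem bond_edge (s : M.Spins) (d : D) :
    M.bond s (M.edge d) = s (M.face d) * s (M.face (M.rev d)) :=
  M.prod_edge_fiber (fun d => s (M.face d)) d

theorem bond_eq_ite (s : M.Spins) (e : M.Edge) :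
    M.bond s e = if e ∈ M.domainWall s then -1 else 1 := by
  obtain ⟨d, rfl⟩ := M.edge_surjective e
  simp only [bond_edge, M.edge_mem_domainWall]
  generalize s (M.face d) = a, s (M.face (M.rev d)) = b
  revert a b
  decide

theorem isingWeight_eq (J : M.Edge → ℝ) (c : Finset M.Edge) (s : M.Spins) :
    Real.exp (∑ e, (if e ∈ c then -J e else J e) * ((M.bond s e : ℤ) : ℝ)) =
      (∏ e, Real.exp (J e)) * ∏ e ∈ M.lowTemp c s, Real.exp (-2 * J e) := by
  rw [Real.exp_sum, ← Finset.prod_ite_mem_eq (M.lowTemp c s), ← Finset.prod_mul_distrib]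
  refine Finset.prod_congr rfl fun e _ => ?_
  simp only [bond_eq_ite, lowTemp, Finset.mem_symmDiff]
  by_cases h : e ∈ c <;> by_cases h' : e ∈ M.domainWall s <;>
    simp [h, h', ← Real.exp_add] <;> ring

/-- Every polygon configuration of class `ε` is the low-temperature expansion of exactly two spin
configurations, which are opposite to each other. -/
theorem sum_lowTemp [Nonempty D] {ε : M.H₁} {c : Finset M.Edge} (hc : c ∈ M.polygons ε)
    (f : Finset M.Edge → ℝ) :
    ∑ s : M.Spins, f (M.lowTemp c s) = 2 * ∑ P ∈ M.polygons ε, f P := by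
  rw [← Finset.sum_fiberwise_of_maps_to (t := M.polygons ε) (g := M.lowTemp c)
    (fun s _ => (exists_lowTemp_eq_iff hc).1 ⟨s, rfl⟩), Finset.mul_sum]
  refine Finset.sum_congr rfl fun P hP => ?_
  obtain ⟨s, rfl⟩ := (exists_lowTemp_eq_iff hc).2 hP
  have hne : s ≠ -s := fun h => by
    obtain ⟨d⟩ := ‹Nonempty D›
    have := congrFun h (M.face d)
    rcases Int.units_eq_one_or (s (M.face d)) with h' | h' <;> simp [h'] at this
  have hfib : ({s' | M.lowTemp c s' = M.lowTemp c s} : Finset M.Spins) = {s, -s} := by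
    ext s'
    simp [lowTemp, domainWall_eq_iff]
  rw [Finset.sum_congr rfl (g := fun _ => f (M.lowTemp c s)) fun s' hs' => by
    rw [(Finset.mem_filter.1 hs').2], hfib, Finset.sum_pair hne, two_mul]

theorem isingZ_eq [Nonempty D] (J : M.Edge → ℝ) {ε : M.H₁} {c : Finset M.Edge}
    (hc : c ∈ M.polygons ε) :
    M.isingZ J c =
      2 * (∏ e, Real.exp (J e)) * ∑ P ∈ M.polygons ε, ∏ e ∈ P, Real.exp (-2 * J e) := by
  rw [isingZ, Finset.sum_congr rfl fun s _ => isingWeight_eq J c s, ← Finset.mul_sum,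
    sum_lowTemp hc fun P => ∏ e ∈ P, Real.exp (-2 * J e)]
  ring

theorem dIsingZ_eq_sum_sq [Nonempty D] (J : M.Edge → ℝ) {rep : M.H₁ → Finset M.Edge}
    (hrep : ∀ ε, rep ε ∈ M.polygons ε) : M.dIsingZ J = ∑ ε, M.isingZ J (rep ε) ^ 2 := by
  refine Finset.sum_congr rfl fun ε _ => ?_
  rw [isingZ_eq J (hrep ε), mul_pow, sq (Finset.sum _ _), Finset.sum_mul_sum, ← Finset.sum_product',
    Finset.mul_sum]
  exact Finset.sum_congr rfl fun Q _ => by rw [dIsingWeight, mul_assoc]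

/-! ### XOR loops -/

theorem mem_dIsingConfigs {Q : Finset M.Edge × Finset M.Edge} :
    Q ∈ M.dIsingConfigs ↔ ∃ ε, Q.1 ∈ M.polygons ε ∧ Q.2 ∈ M.polygons ε := by
  simp [dIsingConfigs]

theorem mem_dIsingConfigs_iff {Q : Finset M.Edge × Finset M.Edge} :
    Q ∈ M.dIsingConfigs ↔ M.IsPolygon Q.1 ∧ symmDiff Q.1 Q.2 ∈ M.polygons 0 := by
  rw [mem_dIsingConfigs]
  constructor
  · rintro ⟨ε, h1, h2⟩
    exact ⟨isPolygon_of_mem h1, (symmDiff_mem_polygons_zero_iff h1).2 h2⟩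
  · rintro ⟨h1, h2⟩
    exact ⟨_, h1.mem_polygons, (symmDiff_mem_polygons_zero_iff h1.mem_polygons).1 h2⟩

/-- The XOR loops do not depend on the choice of the defect lines or of the spins. -/
theorem isXOR_iff {rep : M.H₁ → Finset M.Edge} (hrep : ∀ ε, rep ε ∈ M.polygons ε)
    {Q : Finset M.Edge × Finset M.Edge} (hQ : Q ∈ M.dIsingConfigs) {P : Finset M.Edge} :
    M.IsXOR rep Q P ↔ symmDiff Q.1 Q.2 = P := by
  have key : ∀ c s s', symmDiff (M.lowTemp c s) (M.lowTemp c s') = M.domainWall (s * s') :=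
    fun c s s' => by
      rw [domainWall_mul, lowTemp, lowTemp, symmDiff_symmDiff_symmDiff_comm, symmDiff_self,
        symmDiff_bot]
  constructor
  · rintro ⟨ε, s, s', h1, h2, rfl⟩
    rw [← h1, ← h2, key]
  · rintro rfl
    obtain ⟨ε, h1, h2⟩ := mem_dIsingConfigs.1 hQ
    obtain ⟨s, hs⟩ := (exists_lowTemp_eq_iff (hrep ε)).2 h1
    obtain ⟨s', hs'⟩ := (exists_lowTemp_eq_iff (hrep ε)).2 h2
    exact ⟨ε, s, s', hs, hs', by rw [← hs, ← hs', key]⟩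

theorem dIsingZ_eq_sum_configs (J : M.Edge → ℝ) :
    M.dIsingZ J = ∑ Q ∈ M.dIsingConfigs, M.dIsingWeight J Q := by
  classical
  have h : M.dIsingConfigs = Finset.univ.biUnion fun ε => M.polygons ε ×ˢ M.polygons ε := by
    ext Q
    simp [mem_dIsingConfigs]
  rw [h, Finset.sum_biUnion]
  · rfl
  · intro ε _ ε' _ hne
    refine Finset.disjoint_left.2 fun Q hQ hQ' => hne ?_
    exact eq_of_mem_polygons (Finset.mem_product.1 hQ).1 (Finset.mem_product.1 hQ').1

open scoped Classical in
theorem sum_dIsingWeight_isXOR {rep : M.H₁ → Finset M.Edge} (hrep : ∀ ε, rep ε ∈ M.polygons ε)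
    (J : M.Edge → ℝ) {P : Finset M.Edge} (hP : P ∈ M.polygons 0) :
    ∑ Q ∈ M.dIsingConfigs with M.IsXOR rep Q P, M.dIsingWeight J Q =
      ∑ Q with M.IsPolygon Q, M.dIsingWeight J (Q, symmDiff Q P) := by
  refine Finset.sum_nbij' (fun Q => Q.1) (fun Q => (Q, symmDiff Q P)) ?_ ?_ ?_ ?_ ?_
  · intro Q hQ
    simp only [Finset.mem_filter, Finset.mem_univ, true_and] at hQ ⊢
    exact (mem_dIsingConfigs_iff.1 hQ.1).1
  · intro Q hQ
    simp only [Finset.mem_filter, Finset.mem_univ, true_and] at hQ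
    have hmem : (Q, symmDiff Q P) ∈ M.dIsingConfigs :=
      mem_dIsingConfigs_iff.2 ⟨hQ, by simpa using hP⟩
    exact Finset.mem_filter.2 ⟨hmem, (isXOR_iff hrep hmem).2 (by simp)⟩
  · intro Q hQ
    obtain ⟨h1, h2⟩ := Finset.mem_filter.1 hQ
    rw [isXOR_iff hrep h1] at h2
    subst h2
    simp
  · intro Q _
    rfl
  · intro Q hQ
    obtain ⟨h1, h2⟩ := Finset.mem_filter.1 hQ
    rw [isXOR_iff hrep h1] at h2
    subst h2
    simp

open scoped Classical in
theorem dIsingZ_eq_sum_isXOR {rep : M.H₁ → Finset M.Edge} (hrep : ∀ ε, rep ε ∈ M.polygons ε)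
    (J : M.Edge → ℝ) :
    M.dIsingZ J = ∑ P ∈ M.polygons 0,
      ∑ Q ∈ M.dIsingConfigs with M.IsXOR rep Q P, M.dIsingWeight J Q := by
  rw [dIsingZ_eq_sum_configs, ← Finset.sum_fiberwise_of_maps_to (t := M.polygons 0)
    (g := fun Q : Finset M.Edge × Finset M.Edge => symmDiff Q.1 Q.2)
    (fun Q hQ => (mem_dIsingConfigs_iff.1 hQ).2)]
  refine Finset.sum_congr rfl fun P _ => Finset.sum_congr ?_ fun _ _ => rfl
  exact Finset.filter_congr fun Q hQ => (isXOR_iff hrep hQ).symm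

end

section

variable {D : Type*} (M : SurfaceMap D)

/-! ### The weights and the quadri-tiling graph -/

theorem cosh_mul_aWeight (J : M.Edge → ℝ) (e : M.Edge) :
    Real.cosh (2 * J e) * M.aWeight J e = 1 := by
  have h1 : Real.exp (-4 * J e) = Real.exp (-2 * J e) ^ 2 := by
    rw [← Real.exp_nat_mul]; congr 1; push_cast; ring
  have h2 : Real.exp (2 * J e) * Real.exp (-2 * J e) = 1 := by
    rw [← Real.exp_add]; simp
  rw [Real.cosh_eq, aWeight, h1, show -(2 * J e) = -2 * J e by ring]
  have := Real.exp_pos (-2 * J e)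
  generalize Real.exp (-2 * J e) = x at *
  generalize Real.exp (2 * J e) = y at *
  have : 1 + x ^ 2 ≠ 0 := by positivity
  field_simp
  linear_combination h2

theorem cosh_mul_bWeight (J : M.Edge → ℝ) (e : M.Edge) :
    Real.cosh (2 * J e) * M.bWeight J e = Real.sinh (2 * J e) := by
  have h1 : Real.exp (-4 * J e) = Real.exp (-2 * J e) ^ 2 := by
    rw [← Real.exp_nat_mul]; congr 1; push_cast; ring
  have h2 : Real.exp (2 * J e) * Real.exp (-2 * J e) = 1 := by
    rw [← Real.exp_add]; simp
  rw [Real.cosh_eq, Real.sinh_eq, bWeight, h1, show -(2 * J e) = -2 * J e by ring]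
  have := Real.exp_pos (-2 * J e)
  generalize Real.exp (-2 * J e) = x at *
  generalize Real.exp (2 * J e) = y at *
  have : 1 + x ^ 2 ≠ 0 := by positivity
  field_simp
  linear_combination (-2 * x) * h2

theorem aWeight_sq_add_bWeight_sq (J : M.Edge → ℝ) (e : M.Edge) :
    M.aWeight J e ^ 2 + M.bWeight J e ^ 2 = 1 := by
  have hc : Real.cosh (2 * J e) ≠ 0 := (Real.cosh_pos _).ne'
  have h := Real.cosh_sq (2 * J e)
  apply mul_left_cancel₀ (pow_ne_zero 2 hc)
  rw [mul_add, ← mul_pow, ← mul_pow, cosh_mul_aWeight, cosh_mul_bWeight, h]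
  ring

variable {M}

theorem isEnd_true {d : D} {q : M.QEdge} : M.IsEnd (d, true) q ↔ q.2 = d := by
  obtain ⟨κ, d'⟩ := q
  cases κ <;> simp [IsEnd, otherEnd, eq_comm]

theorem isEnd_false {d : D} {q : M.QEdge} : M.IsEnd (d, false) q ↔
    q = (QKind.external, M.rot⁻¹ d) ∨ q = (QKind.primal, M.rev d) ∨ q = (QKind.dual, d) := by
  have h1 : ∀ d', d = M.rot d' ↔ d' = M.rot⁻¹ d := fun d' => by
    rw [Equiv.Perm.eq_inv_iff_eq, eq_comm]
  have h2 : ∀ d', d = M.rev d' ↔ d' = M.rev d := fun d' =>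
    ⟨fun h => by rw [h, M.rev_rev], fun h => by rw [h, M.rev_rev]⟩
  obtain ⟨κ, d'⟩ := q
  cases κ
  · simpa [IsEnd, otherEnd] using h1 d'
  · simpa [IsEnd, otherEnd] using h2 d'
  · simp [IsEnd, otherEnd, eq_comm]

variable (M) [Fintype D]

/-! ### Vertex spins and the mixed contour expansion -/

/-- The product of the spins of a function on the vertices of `G` at the two ends of an edge. -/
noncomputable def cobond (r : M.Vertex → ℤˣ) (e : M.Edge) : ℤˣ :=
  ∏ d with M.edge d = e, r (M.vertex d)

theorem cobond_edge (r : M.Vertex → ℤˣ) (d : D) :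
    M.cobond r (M.edge d) = r (M.vertex d) * r (M.vertex (M.rev d)) :=
  M.prod_edge_fiber (fun d => r (M.vertex d)) d

theorem prod_cobond (r : M.Vertex → ℤˣ) (Q : Finset M.Edge) :
    ∏ e ∈ Q, M.cobond r e =
      ∏ v, r v ^ Finset.card {d : D | M.vertex d = v ∧ M.edge d ∈ Q} := by
  have h1 : ∏ e ∈ Q, M.cobond r e = ∏ d with M.edge d ∈ Q, r (M.vertex d) := by
    rw [← Finset.prod_fiberwise_of_maps_to (t := Q) (g := M.edge) (by simp)]
    refine Finset.prod_congr rfl fun e he => Finset.prod_congr ?_ fun _ _ => rfl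
    ext d
    simp only [Finset.mem_filter, Finset.mem_univ, true_and]
    exact ⟨fun h => ⟨h ▸ he, h⟩, fun h => h.2⟩
  rw [h1, ← Finset.prod_fiberwise (g := M.vertex)]
  refine Finset.prod_congr rfl fun v _ => ?_
  rw [Finset.prod_congr rfl (g := fun _ => r v) fun d hd => by rw [(Finset.mem_filter.1 hd).2],
    Finset.prod_const, Finset.filter_filter]
  simp only [and_comm]

open scoped Classical in
/-- Summing over vertex spins detects the evenness of all degrees. -/
theorem sum_prod_cobond (Q : Finset M.Edge) :
    ∑ r : M.Vertex → ℤˣ, ∏ e ∈ Q, ((M.cobond r e : ℤ) : ℝ) =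
      if M.IsPolygon Q then 2 ^ Fintype.card M.Vertex else 0 := by
  have h1 : ∀ r : M.Vertex → ℤˣ, ∏ e ∈ Q, ((M.cobond r e : ℤ) : ℝ) =
      ∏ v, ((r v : ℤ) : ℝ) ^ Finset.card {d : D | M.vertex d = v ∧ M.edge d ∈ Q} := fun r => by
    have := congrArg (fun u : ℤˣ => ((u : ℤ) : ℝ)) (M.prod_cobond r Q)
    simpa [Units.coe_prod] using this
  have h2 : ∀ n : ℕ, ∑ u : ℤˣ, ((u : ℤ) : ℝ) ^ n = if Even n then 2 else 0 := fun n => by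
    have : (Finset.univ : Finset ℤˣ) = {1, -1} := rfl
    rw [this, Finset.sum_pair (by decide)]
    rcases Nat.even_or_odd n with h | h
    · simp [h, h.neg_one_pow]; norm_num
    · simp [Nat.not_even_iff_odd.2 h, h.neg_one_pow]
  rw [Finset.sum_congr rfl fun r _ => h1 r, ← Fintype.piFinset_univ,
    ← Finset.prod_univ_sum (fun _ => Finset.univ) fun v (u : ℤˣ) =>
      ((u : ℤ) : ℝ) ^ Finset.card {d : D | M.vertex d = v ∧ M.edge d ∈ Q}]
  simp only [h2]
  rw [Finset.prod_ite_zero]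
  simp only [IsPolygon, Finset.mem_univ, true_imp_iff, Finset.prod_const, Finset.card_univ]
  congr

/-- The weight of the pair formed by a set of edges `P` of `G` and the set `P'` of the dual edges
along which the vertex spins `r` change: `∏_{P} a ∏_{P'} b` if no edge of `P` crosses `P'`, and `0`
otherwise. -/
noncomputable def mixedWeight (a b : M.Edge → ℝ) (P : Finset M.Edge) (r : M.Vertex → ℤˣ) : ℝ :=
  ∏ e, if e ∈ P then (if M.cobond r e = 1 then a e else 0) else
    (if M.cobond r e = 1 then 1 else b e)

theorem dIsingWeight_symmDiff (J : M.Edge → ℝ) (P Q : Finset M.Edge) :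
    M.dIsingWeight J (Q, symmDiff Q P) =
      4 * ((∏ e ∈ Q, if e ∈ P then 1 else Real.exp (-(2 * J e))) *
        ∏ e ∈ Finset.univ \ Q, if e ∈ P then 1 else Real.exp (2 * J e)) := by
  rw [dIsingWeight, mul_pow, ← Finset.prod_pow, mul_assoc, mul_assoc,
    ← Finset.compl_eq_univ_sdiff, ← Finset.prod_ite_mem_eq Q, ← Finset.prod_ite_mem_eq Qᶜ,
    ← Finset.prod_ite_mem_eq Q, ← Finset.prod_ite_mem_eq (symmDiff Q P)]
  simp only [← Finset.prod_mul_distrib]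
  norm_num only
  congr 1
  refine Finset.prod_congr rfl fun e _ => ?_
  simp only [Finset.mem_symmDiff, Finset.mem_compl]
  by_cases h : e ∈ Q <;> by_cases h' : e ∈ P <;>
    simp [h, h', ← Real.exp_add, ← Real.exp_nat_mul]

open scoped Classical in
/-- The vertex spins `r` turn the sum over polygon configurations `Q` into a free sum over all sets
of edges, which factorizes over the edges. -/
theorem sum_dIsingWeight_symmDiff (J : M.Edge → ℝ) (P : Finset M.Edge) :
    2 ^ Fintype.card M.Vertex * ∑ Q with M.IsPolygon Q, M.dIsingWeight J (Q, symmDiff Q P) =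
      4 * 2 ^ Fintype.card M.Edge * (∏ e, Real.cosh (2 * J e)) *
        ∑ r, M.mixedWeight (M.aWeight J) (M.bWeight J) P r := by
  -- for fixed `r` the sum over `Q` is the expansion of a product of binomials
  have hfac : ∀ r : M.Vertex → ℤˣ,
      ∑ Q, (∏ e ∈ Q, ((M.cobond r e : ℤ) : ℝ)) * M.dIsingWeight J (Q, symmDiff Q P) =
        4 * ∏ e, (((M.cobond r e : ℤ) : ℝ) * (if e ∈ P then 1 else Real.exp (-(2 * J e))) +
          if e ∈ P then 1 else Real.exp (2 * J e)) := fun r => by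
    rw [Finset.prod_add, Finset.powerset_univ, Finset.mul_sum]
    refine Finset.sum_congr rfl fun Q _ => ?_
    rw [dIsingWeight_symmDiff, Finset.prod_mul_distrib]
    ring
  have hloc : ∀ (r : M.Vertex → ℤˣ) (e : M.Edge),
      ((M.cobond r e : ℤ) : ℝ) * (if e ∈ P then 1 else Real.exp (-(2 * J e))) +
          (if e ∈ P then 1 else Real.exp (2 * J e)) =
        2 * Real.cosh (2 * J e) * if e ∈ P then (if M.cobond r e = 1 then M.aWeight J e else 0)
          else (if M.cobond r e = 1 then 1 else M.bWeight J e) := fun r e => by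
    have ha := M.cosh_mul_aWeight J e
    have hb := M.cosh_mul_bWeight J e
    rcases Int.units_eq_one_or (M.cobond r e) with h | h <;> by_cases h' : e ∈ P <;>
      simp [h, h']
    · linear_combination (-2) * ha
    · rw [Real.cosh_eq]; ring
    · rw [mul_assoc, hb, Real.sinh_eq]; ring
  calc _ = ∑ Q, (if M.IsPolygon Q then 2 ^ Fintype.card M.Vertex else 0) *
        M.dIsingWeight J (Q, symmDiff Q P) := by
        rw [Finset.sum_filter, Finset.mul_sum]
        exact Finset.sum_congr rfl fun Q _ => by split_ifs <;> simp
    _ = ∑ r : M.Vertex → ℤˣ, ∑ Q, (∏ e ∈ Q, ((M.cobond r e : ℤ) : ℝ)) *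
        M.dIsingWeight J (Q, symmDiff Q P) := by
        rw [Finset.sum_comm]
        exact Finset.sum_congr rfl fun Q _ => by rw [← sum_prod_cobond, Finset.sum_mul]
    _ = _ := by
        rw [Finset.mul_sum]
        refine Finset.sum_congr rfl fun r _ => ?_
        rw [hfac, Finset.prod_congr rfl fun e _ => hloc r e, Finset.prod_mul_distrib,
          Finset.prod_mul_distrib, Finset.prod_const, Finset.card_univ, mixedWeight]
        ring

/-! ### Dimer configurations as assignments of kinds -/

variable {M}

/-- The set of edges that contains, for every dart `d`, the edge of kind `k d` at `(d, true)`. -/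
def ofKinds (k : D → QKind) : Finset M.QEdge :=
  Finset.univ.map ⟨fun d => (k d, d), fun _ _ h => (Prod.ext_iff.1 h).2⟩

theorem mem_ofKinds {k : D → QKind} {q : M.QEdge} : q ∈ ofKinds (M := M) k ↔ k q.2 = q.1 := by
  obtain ⟨κ, d⟩ := q
  rw [ofKinds, Finset.mem_map]
  constructor
  · rintro ⟨d', _, h⟩
    cases h
    rfl
  · intro h
    exact ⟨d, Finset.mem_univ d, Prod.ext h rfl⟩

variable (M) in
theorem ofKinds_injective : Function.Injective (ofKinds (M := M)) := by
  intro k k' h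
  funext d
  have : (k d, d) ∈ ofKinds (M := M) k' := h ▸ mem_ofKinds.2 rfl
  exact (mem_ofKinds.1 this).symm

/-- Exactly one of three propositions holds. -/
def ExactlyOne (p q r : Prop) : Prop :=
  (p ∧ ¬q ∧ ¬r) ∨ (¬p ∧ q ∧ ¬r) ∨ (¬p ∧ ¬q ∧ r)

theorem isDimer_ofKinds {k : D → QKind} : M.IsDimer (ofKinds k) ↔
    ∀ d, ExactlyOne (k (M.rot⁻¹ d) = QKind.external) (k (M.rev d) = QKind.primal)
      (k d = QKind.dual) := by
  have htrue : ∀ d, ∃! q, q ∈ ofKinds (M := M) k ∧ M.IsEnd (d, true) q := fun d => by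
    refine ⟨(k d, d), ⟨mem_ofKinds.2 rfl, isEnd_true.2 rfl⟩, ?_⟩
    rintro ⟨κ, d'⟩ ⟨h1, h2⟩
    obtain rfl : d' = d := isEnd_true.1 h2
    exact Prod.ext (mem_ofKinds.1 h1).symm rfl
  have hfalse : ∀ d, (∃! q, q ∈ ofKinds (M := M) k ∧ M.IsEnd (d, false) q) ↔
      ExactlyOne (k (M.rot⁻¹ d) = QKind.external) (k (M.rev d) = QKind.primal)
        (k d = QKind.dual) := fun d => by
    simp only [isEnd_false, mem_ofKinds]
    constructor
    · rintro ⟨q, ⟨hq, hq'⟩, hu⟩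
      have h1 := hu (QKind.external, M.rot⁻¹ d)
      have h2 := hu (QKind.primal, M.rev d)
      have h3 := hu (QKind.dual, d)
      rcases hq' with rfl | rfl | rfl
      · exact Or.inl ⟨hq, fun h => by simpa using h2 ⟨h, by simp⟩,
          fun h => by simpa using h3 ⟨h, by simp⟩⟩
      · exact Or.inr (Or.inl ⟨fun h => by simpa using h1 ⟨h, by simp⟩, hq,
          fun h => by simpa using h3 ⟨h, by simp⟩⟩)
      · exact Or.inr (Or.inr ⟨fun h => by simpa using h1 ⟨h, by simp⟩,
          fun h => by simpa using h2 ⟨h, by simp⟩, hq⟩)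
    · rintro (⟨h1, h2, h3⟩ | ⟨h1, h2, h3⟩ | ⟨h1, h2, h3⟩)
      · refine ⟨_, ⟨h1, Or.inl rfl⟩, ?_⟩
        rintro q ⟨hq, rfl | rfl | rfl⟩ <;> simp_all
      · refine ⟨_, ⟨h2, Or.inr (Or.inl rfl)⟩, ?_⟩
        rintro q ⟨hq, rfl | rfl | rfl⟩ <;> simp_all
      · refine ⟨_, ⟨h3, Or.inr (Or.inr rfl)⟩, ?_⟩
        rintro q ⟨hq, rfl | rfl | rfl⟩ <;> simp_all
  constructor
  · exact fun h d => (hfalse d).1 (h _)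
  · rintro h ⟨d, (_ | _)⟩
    · exact (hfalse d).2 (h d)
    · exact htrue d

theorem IsDimer.exists_ofKinds {X : Finset M.QEdge} (hX : M.IsDimer X) : ∃ k, ofKinds k = X := by
  choose q hq hu using fun d => hX (d, true)
  have hq2 : ∀ d, (q d).2 = d := fun d => isEnd_true.1 (hq d).2
  refine ⟨fun d => (q d).1, Finset.ext fun p => ?_⟩
  rw [mem_ofKinds]
  constructor
  · intro h
    have : p = q p.2 := Prod.ext h.symm (hq2 _).symm
    rw [this]
    exact (hq _).1
  · intro hp
    rw [← hu p.2 p ⟨hp, isEnd_true.2 rfl⟩]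

theorem prod_ofKinds (f : M.QEdge → ℝ) (k : D → QKind) :
    ∏ q ∈ ofKinds k, f q = ∏ d, f (k d, d) :=
  Finset.prod_map _ _ _

theorem mem_sixVertex_ofKinds {k : D → QKind} {d : D} :
    d ∈ M.sixVertex (ofKinds k) ↔ k d = QKind.external :=
  mem_ofKinds

end

section

variable {D : Type*} {M : SurfaceMap D}

/-! ### The 6-vertex model of the corners -/

/-- The 6-vertex weight of a medial vertex with the states `x₁, x₂, x₃, x₄` of the medial edges
around it, where `x₁` and `x₄` lie on the same side of the edge of `G`. -/
noncomputable def sixVertexWeight (a b : ℝ) (x₁ x₂ x₃ x₄ : Bool) : ℝ :=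
  if x₁ = x₂ ∧ x₃ = x₄ ∧ x₁ = x₃ then 1 else if x₁ = x₄ ∧ x₂ = x₃ then a else
    if x₁ = x₂ ∧ x₃ = x₄ then b else 0

/-- The 6-vertex weight at the middle of the edge of `d` in the configuration `c` of corners. -/
noncomputable def localWeight (M : SurfaceMap D) (a b : M.Edge → ℝ) (c : D → Bool) (d : D) : ℝ :=
  sixVertexWeight (a (M.edge d)) (b (M.edge d)) (c d) (c (M.rot⁻¹ d)) (c (M.rev d))
    (c (M.rot⁻¹ (M.rev d)))

/-- The 6-vertex rule at the middle of the edge of `d`: the states of the corners agree in pairs,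
along the edge or across it. -/
def SixVertexAt (M : SurfaceMap D) (c : D → Bool) (d : D) : Prop :=
  (c d = c (M.rot⁻¹ (M.rev d)) ∧ c (M.rot⁻¹ d) = c (M.rev d)) ∨
    (c d = c (M.rot⁻¹ d) ∧ c (M.rev d) = c (M.rot⁻¹ (M.rev d)))

theorem sixVertexAt_of_localWeight_ne_zero {a b : M.Edge → ℝ} {c : D → Bool} {d : D}
    (h : M.localWeight a b c d ≠ 0) : M.SixVertexAt c d := by
  unfold localWeight sixVertexWeight at h
  unfold SixVertexAt
  split_ifs at h with h1 h2 h3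
  · exact Or.inr ⟨h1.1, h1.2.1⟩
  · exact Or.inl h2
  · exact Or.inr h3
  · exact absurd rfl h

theorem SixVertexAt.rev {c : D → Bool} {d : D} (h : M.SixVertexAt c d) :
    M.SixVertexAt c (M.rev d) := by
  unfold SixVertexAt at h ⊢
  rw [M.rev_rev]
  rcases h with ⟨h1, h2⟩ | ⟨h1, h2⟩
  · exact Or.inl ⟨h2.symm, h1.symm⟩
  · exact Or.inr ⟨h2, h1⟩

/-- The matching rule at the vertex `(d, false)`, and the meaning of external kinds, in terms of
the kinds `x` and `y` of `d` and `rev d` and the states `z` and `t` of the corners `d` and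
`rot⁻¹ d`. -/
def QuadrangleRule (x y : QKind) (z t : Bool) : Prop :=
  (x = QKind.external ↔ z = true) ∧
    ExactlyOne (t = true) (y = QKind.primal) (x = QKind.dual)

open scoped Classical in
/-- Matching a quadrangle inside, given its external edges, produces the 6-vertex weight. The
hypothesis says that the weights of the two matchings of an empty quadrangle add up to `1`. -/
theorem sum_kinds_eq_sixVertexWeight {a b : ℝ} (hab : a ^ 2 + b ^ 2 = 1) (w : QKind → ℝ)
    (hw : w QKind.external = 1) (ha : w QKind.primal = a) (hb : w QKind.dual = b)
    (x₁ x₂ x₃ x₄ : Bool) :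
    ∑ xy : QKind × QKind, (if QuadrangleRule xy.1 xy.2 x₁ x₂ then w xy.1 else 0) *
      (if QuadrangleRule xy.2 xy.1 x₃ x₄ then w xy.2 else 0) = sixVertexWeight a b x₁ x₂ x₃ x₄ := by
  have hu : (Finset.univ : Finset QKind) = {QKind.external, QKind.primal, QKind.dual} := by
    ext x; cases x <;> simp
  have hs : ∀ f : QKind → ℝ, ∑ x, f x = f QKind.external + f QKind.primal + f QKind.dual :=
    fun f => by rw [hu]; simp [add_assoc]
  rw [Fintype.sum_prod_type]
  simp only [hs, hw, ha, hb, QuadrangleRule, ExactlyOne]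
  cases x₁ <;> cases x₂ <;> cases x₃ <;> cases x₄ <;> simp [sixVertexWeight]
  rw [← hab]; ring

/-- The corners at which the spin of the face agrees with the spin of the vertex. -/
def spinCorners (M : SurfaceMap D) (s : M.Spins) (r : M.Vertex → ℤˣ) (d : D) : Bool :=
  decide (s (M.face d) = r (M.vertex d))

theorem spinCorners_injective (s : M.Spins) : Function.Injective (M.spinCorners s) := by
  intro r r' h
  funext v
  obtain ⟨d, rfl⟩ := M.vertex_surjective v
  have := congrFun h d
  unfold spinCorners at this
  revert this
  generalize s (M.face d) = x, r (M.vertex d) = y, r' (M.vertex d) = z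
  revert x y z
  decide

theorem exists_eq_comp_vertex {α : Type*} {f : D → α} (hf : ∀ d, f (M.rot⁻¹ d) = f d) :
    ∃ r : M.Vertex → α, ∀ d, f d = r (M.vertex d) := by
  have hz : ∀ (i : ℤ) (d : D), f ((M.rot ^ i) d) = f d := by
    intro i
    induction i with
    | zero => simp
    | succ i ih =>
      intro d
      rw [zpow_add_one, Equiv.Perm.mul_apply, ih, ← hf (M.rot d)]
      simp
    | pred i ih =>
      intro d
      rw [zpow_sub_one, Equiv.Perm.mul_apply, ih, hf]
  exact ⟨Quotient.lift f (by rintro d _ ⟨i, rfl⟩; exact (hz i d).symm), fun d => rfl⟩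

variable [Fintype D]

theorem prod_darts (f : D → ℝ) :
    ∏ d, f d = ∏ e : M.Edge, f (M.outDart e) * f (M.rev (M.outDart e)) := by
  rw [← Finset.prod_fiberwise (g := M.edge)]
  refine Finset.prod_congr rfl fun e _ => ?_
  rw [← M.prod_edge_fiber]
  refine Finset.prod_congr ?_ fun _ _ => rfl
  rw [M.edge_outDart]

open scoped Classical in
/-- A function on darts is a choice of a pair of values for every edge. -/
theorem sum_prod_edges {K : Type*} [Fintype K] (F : M.Edge → K × K → ℝ) :
    ∑ k : D → K, ∏ e, F e (k (M.outDart e), k (M.rev (M.outDart e))) =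
      ∏ e, ∑ xy, F e xy := by
  have hd : ∀ d, d = M.outDart (M.edge d) ∨ d = M.rev (M.outDart (M.edge d)) := fun d =>
    M.edge_eq_iff.1 (M.edge_outDart _).symm
  let Φ : (D → K) → M.Edge → K × K := fun k e => (k (M.outDart e), k (M.rev (M.outDart e)))
  have hΦ : Function.Bijective Φ := by
    constructor
    · intro k k' h
      funext d
      have := Prod.ext_iff.1 (congrFun h (M.edge d))
      rcases hd d with h' | h' <;> rw [h']
      · exact this.1
      · exact this.2
    · intro m
      refine ⟨fun d => if d = M.outDart (M.edge d) then (m (M.edge d)).1 else (m (M.edge d)).2,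
        funext fun e => Prod.ext ?_ ?_⟩
      · simp [Φ, M.edge_outDart]
      · simp [Φ, M.edge_outDart, M.edge_rev, M.rev_ne]
  rw [hΦ.sum_comp (fun m => ∏ e, F e (m e)), Finset.prod_univ_sum, Fintype.piFinset_univ]

open scoped Classical in
/-- The dimer configurations with given medial edges decouple into local matchings of the
quadrangles. -/
theorem sum_kinds_eq_prod_localWeight {a b : M.Edge → ℝ} (hab : ∀ e, a e ^ 2 + b e ^ 2 = 1)
    (c : D → Bool) :
    ∑ k : D → QKind, (if M.IsDimer (ofKinds k) ∧ (∀ d, k d = QKind.external ↔ c d = true) then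
      ∏ d, M.qWeight a b (k d, d) else 0) =
      ∏ e : M.Edge, M.localWeight a b c (M.outDart e) := by
  -- the state of the corner `rot⁻¹ d` stands for the kind of the dart `rot⁻¹ d`, so that only the
  -- kinds of `d` and `rev d` are coupled
  have hcond : ∀ k : D → QKind,
      (M.IsDimer (ofKinds k) ∧ ∀ d, k d = QKind.external ↔ c d = true) ↔
        ∀ d ∈ Finset.univ, QuadrangleRule (k d) (k (M.rev d)) (c d) (c (M.rot⁻¹ d)) := fun k => by
    rw [isDimer_ofKinds, and_comm, ← forall_and]
    constructor
    · intro h d _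
      refine ⟨(h d).1, ?_⟩
      have := (h d).2
      rwa [(h (M.rot⁻¹ d)).1] at this
    · intro h d
      refine ⟨(h d (Finset.mem_univ _)).1, ?_⟩
      have := (h d (Finset.mem_univ _)).2
      rwa [← (h (M.rot⁻¹ d) (Finset.mem_univ _)).1] at this
  have hloc : ∀ e : M.Edge, M.localWeight a b c (M.outDart e) =
      ∑ xy : QKind × QKind,
        (if QuadrangleRule xy.1 xy.2 (c (M.outDart e)) (c (M.rot⁻¹ (M.outDart e))) then
          M.qWeight a b (xy.1, M.outDart e) else 0) *
        (if QuadrangleRule xy.2 xy.1 (c (M.rev (M.outDart e)))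
            (c (M.rot⁻¹ (M.rev (M.outDart e)))) then
          M.qWeight a b (xy.2, M.rev (M.outDart e)) else 0) := fun e => by
    have hq : ∀ κ, M.qWeight a b (κ, M.rev (M.outDart e)) =
        M.qWeight a b (κ, M.outDart e) := fun κ => by
      cases κ <;> simp [qWeight, M.edge_rev]
    simp only [hq]
    rw [sum_kinds_eq_sixVertexWeight (hab e) (fun κ => M.qWeight a b (κ, M.outDart e)) rfl
      (by simp [qWeight, M.edge_outDart]) (by simp [qWeight, M.edge_outDart]),
      localWeight, M.edge_outDart]
  rw [Finset.prod_congr rfl fun e _ => hloc e, ← sum_prod_edges]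
  refine Finset.sum_congr rfl fun k _ => ?_
  simp only [hcond]
  have hdarts := prod_darts (M := M) fun d =>
    if QuadrangleRule (k d) (k (M.rev d)) (c d) (c (M.rot⁻¹ d)) then M.qWeight a b (k d, d) else 0
  simp only [M.rev_rev] at hdarts
  rw [← hdarts, Finset.prod_ite_zero]
  congr

/-! ### Contours of 6-vertex configurations -/

/-- Under the 6-vertex rule, the primal
contour consists of the edges between two consecutive corners in different states. -/
theorem edge_mem_primalContour {c : D → Bool} (hc : ∀ d, M.SixVertexAt c d) (d : D) :
    M.edge d ∈ M.primalContour {d | c d = true} ↔ c d ≠ c (M.rot⁻¹ d) := by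
  have h := hc d
  have h' := (hc d).rev
  have hn : ∀ d, M.nextInFace d = M.rot⁻¹ (M.rev d) := fun d => rfl
  simp only [primalContour, Finset.mem_filter, Finset.mem_univ, true_and, M.edge_eq_iff,
    Set.mem_ofPred_eq, hn, ← Bool.eq_iff_iff]
  unfold SixVertexAt at h h'
  constructor
  · rintro ⟨d', rfl | rfl, h1, h2, h3⟩
    · exact h3
    · rw [M.rev_rev] at h1 h2
      intro h4
      exact h3 (by rw [h1, ← h4, h2])
  · intro h1
    rcases h with h | h
    · exact ⟨d, Or.inl rfl, h.1, h.2, h1⟩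
    · exact absurd h.1 h1

theorem localWeight_spinCorners (a b : M.Edge → ℝ) (s : M.Spins) (r : M.Vertex → ℤˣ) (d : D) :
    M.localWeight a b (M.spinCorners s r) d =
      if M.edge d ∈ M.domainWall s then (if M.cobond r (M.edge d) = 1 then a (M.edge d) else 0)
        else (if M.cobond r (M.edge d) = 1 then 1 else b (M.edge d)) := by
  simp only [localWeight, spinCorners, M.edge_mem_domainWall, M.cobond_edge, M.face_rot_inv,
    M.vertex_rot_inv, M.rev_rev]
  rcases Int.units_eq_one_or (s (M.face d)) with h1 | h1 <;>
    rcases Int.units_eq_one_or (s (M.face (M.rev d))) with h2 | h2 <;>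
    rcases Int.units_eq_one_or (r (M.vertex d)) with h3 | h3 <;>
    rcases Int.units_eq_one_or (r (M.vertex (M.rev d))) with h4 | h4 <;>
    simp [sixVertexWeight, h1, h2, h3, h4]

theorem primalContour_spinCorners {s : M.Spins} {r : M.Vertex → ℤˣ}
    (hc : ∀ d, M.SixVertexAt (M.spinCorners s r) d) :
    M.primalContour {d | M.spinCorners s r d = true} = M.domainWall s := by
  ext e
  obtain ⟨d, rfl⟩ := M.edge_surjective e
  rw [edge_mem_primalContour hc, M.edge_mem_domainWall, spinCorners, spinCorners, M.face_rot_inv,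
    M.vertex_rot_inv]
  generalize s (M.face d) = x, s (M.face (M.rev d)) = y, r (M.vertex d) = z
  revert x y z
  decide

/-- A 6-vertex configuration whose primal contour is a domain wall is given by spins of faces and
vertices: along the rotation at a vertex, its state changes exactly when the face spin does. -/
theorem exists_spinCorners_eq {s : M.Spins} {c : D → Bool} (hc : ∀ d, M.SixVertexAt c d)
    (h : M.primalContour {d | c d = true} = M.domainWall s) : ∃ r, M.spinCorners s r = c := by
  have hcs : ∀ d, c d ≠ c (M.rot⁻¹ d) ↔ s (M.face d) ≠ s (M.face (M.rot⁻¹ d)) := fun d => by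
    rw [← edge_mem_primalContour hc, h, M.edge_mem_domainWall, M.face_rot_inv]
  -- the sign that says whether the vertex spin agrees with the face spin, times the face spin
  obtain ⟨r, hr⟩ := exists_eq_comp_vertex (M := M)
    (f := fun d => s (M.face d) * if c d then 1 else -1) fun d => by
      have := hcs d
      revert this
      generalize s (M.face d) = x, s (M.face (M.rot⁻¹ d)) = y, c d = z, c (M.rot⁻¹ d) = t
      revert x y z t
      decide
  refine ⟨r, funext fun d => ?_⟩
  rw [spinCorners, ← hr]
  generalize s (M.face d) = x, c d = z
  revert x z
  decide

theorem prod_localWeight_spinCorners (a b : M.Edge → ℝ) (s : M.Spins) (r : M.Vertex → ℤˣ) :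
    ∏ e : M.Edge, M.localWeight a b (M.spinCorners s r) (M.outDart e) =
      M.mixedWeight a b (M.domainWall s) r := by
  refine Finset.prod_congr rfl fun e _ => ?_
  rw [localWeight_spinCorners, M.edge_outDart]

theorem sixVertexAt_of_prod_localWeight_ne_zero {a b : M.Edge → ℝ} {c : D → Bool}
    (h : ∏ e : M.Edge, M.localWeight a b c (M.outDart e) ≠ 0) (d : D) :
    M.SixVertexAt c d := by
  have hd := sixVertexAt_of_localWeight_ne_zero
    (Finset.prod_ne_zero_iff.1 h (M.edge d) (Finset.mem_univ _))
  rcases M.edge_eq_iff.1 (M.edge_outDart _).symm with h' | h'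
  · rwa [← h'] at hd
  · have := hd.rev
    rwa [← h'] at this

open scoped Classical in
/-- The 6-vertex configurations with primal contour `M.domainWall s` are parametrized by vertex
spins. -/
theorem sum_sixVertex_eq_sum_mixedWeight (a b : M.Edge → ℝ) (s : M.Spins) :
    ∑ c : D → Bool, (if M.primalContour {d | c d = true} = M.domainWall s then
      ∏ e : M.Edge, M.localWeight a b c (M.outDart e) else 0) =
      ∑ r, M.mixedWeight a b (M.domainWall s) r := by
  symm
  refine Finset.sum_of_injOn (M.spinCorners s) (spinCorners_injective s).injOn
    (fun _ _ => Finset.mem_coe.2 (Finset.mem_univ _)) ?_ ?_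
  · intro c _ hc
    by_contra hne
    rw [ite_eq_right_iff, Classical.not_imp] at hne
    obtain ⟨r, rfl⟩ := exists_spinCorners_eq (sixVertexAt_of_prod_localWeight_ne_zero hne.2) hne.1
    exact hc ⟨r, by simp, rfl⟩
  · intro r _
    rw [← prod_localWeight_spinCorners]
    split_ifs with h
    · rfl
    · by_contra hne
      exact h (primalContour_spinCorners (sixVertexAt_of_prod_localWeight_ne_zero hne))

open scoped Classical in
theorem sum_dimers₀_eq_sum_mixedWeight {a b : M.Edge → ℝ} (hab : ∀ e, a e ^ 2 + b e ^ 2 = 1)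
    {P : Finset M.Edge} (hP : P ∈ M.polygons 0) :
    ∑ X ∈ M.dimers₀ with M.poly₁ X = P, ∏ q ∈ X, M.qWeight a b q =
      ∑ r, M.mixedWeight a b P r := by
  obtain ⟨s, rfl⟩ := mem_polygons_zero.1 hP
  rw [← sum_sixVertex_eq_sum_mixedWeight]
  have h1 : ∑ X ∈ M.dimers₀ with M.poly₁ X = M.domainWall s, ∏ q ∈ X, M.qWeight a b q =
      ∑ k : D → QKind with M.IsDimer (ofKinds k) ∧ M.poly₁ (ofKinds k) = M.domainWall s,
        ∏ d, M.qWeight a b (k d, d) := by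
    symm
    refine Finset.sum_bij (fun k _ => ofKinds k) ?_ (fun k _ k' _ h => M.ofKinds_injective h) ?_ ?_
    · intro k hk
      obtain ⟨h1, h2⟩ := (Finset.mem_filter.1 hk).2
      refine Finset.mem_filter.2 ⟨?_, h2⟩
      simp only [dimers₀, Finset.mem_filter, Finset.mem_univ, true_and]
      exact ⟨h1, h2 ▸ hP⟩
    · intro X hX
      obtain ⟨h1, h2⟩ := Finset.mem_filter.1 hX
      simp only [dimers₀, Finset.mem_filter, Finset.mem_univ, true_and] at h1
      obtain ⟨k, rfl⟩ := h1.1.exists_ofKinds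
      exact ⟨k, Finset.mem_filter.2 ⟨Finset.mem_univ _, h1.1, h2⟩, rfl⟩
    · exact fun k _ => (prod_ofKinds _ k).symm
  rw [h1, ← Finset.sum_fiberwise (g := fun (k : D → QKind) d => decide (k d = QKind.external))]
  refine Finset.sum_congr rfl fun c _ => ?_
  rw [Finset.filter_filter, Finset.sum_filter, ← sum_kinds_eq_prod_localWeight hab]
  have hpoly : ∀ k : D → QKind, (∀ d, k d = QKind.external ↔ c d = true) →
      M.poly₁ (ofKinds k) = M.primalContour {d | c d = true} := fun k hk =>
    congrArg M.primalContour (Set.ext fun d => mem_sixVertex_ofKinds.trans (hk d))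
  have hfun : ∀ k : D → QKind, (fun d => decide (k d = QKind.external)) = c ↔
      ∀ d, k d = QKind.external ↔ c d = true := fun k => by
    rw [funext_iff]
    exact forall_congr' fun d => by rw [Bool.eq_iff_iff, decide_eq_true_iff]
  simp only [hfun]
  split_ifs with h
  · refine Finset.sum_congr rfl fun k _ => if_congr ?_ rfl rfl
    exact ⟨fun h' => ⟨h'.1.1, h'.2⟩, fun h' => ⟨⟨h'.1, (hpoly k h'.2).trans h⟩, h'.2⟩⟩
  · refine Finset.sum_eq_zero fun k _ => if_neg fun h' => h ?_
    rw [← hpoly k h'.2, h'.1.2]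

/-! ### Comparison of the two models -/

open scoped Classical in
theorem dimerZ₀_eq_sum (a b : M.Edge → ℝ) : M.dimerZ₀ a b = ∑ P ∈ M.polygons 0,
    ∑ X ∈ M.dimers₀ with M.poly₁ X = P, ∏ q ∈ X, M.qWeight a b q := by
  rw [dimerZ₀, Finset.sum_fiberwise_of_maps_to]
  intro X hX
  simp only [dimers₀, Finset.mem_filter, Finset.mem_univ, true_and] at hX
  exact hX.2

open scoped Classical in
/-- The identity of partition functions, refined by the XOR loops of the double Ising model and the
primal contours of the dimer model. -/
theorem sum_dIsingWeight_isXOR_eq {g : ℕ} (hg : M.HasGenus g) (J : M.Edge → ℝ)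
    {rep : M.H₁ → Finset M.Edge} (hrep : ∀ ε, rep ε ∈ M.polygons ε) {P : Finset M.Edge}
    (hP : P ∈ M.polygons 0) :
    ∑ Q ∈ M.dIsingConfigs with M.IsXOR rep Q P, M.dIsingWeight J Q =
      2 ^ (Fintype.card M.Face + 2 * g) * (∏ e, Real.cosh (2 * J e)) *
        ∑ X ∈ M.dimers₀ with M.poly₁ X = P, ∏ q ∈ X, M.qWeight (M.aWeight J) (M.bWeight J) q := by
  have hcard : Fintype.card M.Edge + 2 =
      Fintype.card M.Vertex + (Fintype.card M.Face + 2 * g) := by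
    unfold HasGenus at hg
    omega
  have hpow : (4 : ℝ) * 2 ^ Fintype.card M.Edge =
      2 ^ Fintype.card M.Vertex * 2 ^ (Fintype.card M.Face + 2 * g) := by
    rw [← pow_add, ← hcard, pow_add]
    ring
  rw [sum_dIsingWeight_isXOR hrep J hP,
    sum_dimers₀_eq_sum_mixedWeight (M.aWeight_sq_add_bWeight_sq J) hP]
  apply mul_left_cancel₀ (pow_ne_zero (Fintype.card M.Vertex) (two_ne_zero (α := ℝ)))
  rw [sum_dIsingWeight_symmDiff, hpow]
  ring

end

end SurfaceMap

theorem mainTheorem1 {D : Type*} [Fintype D] [Nonempty D] (M : SurfaceMap D)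
    (g : ℕ) (hg : M.HasGenus g)
    (J : M.Edge → ℝ) (hJ : ∀ e, 0 < J e)
    (rep : M.H₁ → Finset M.Edge) (hrep : ∀ ε, rep ε ∈ M.polygons ε) :
    M.dIsingZ J = ∑ ε, M.isingZ J (rep ε) ^ 2 ∧
    M.dIsingZ J =
      2 ^ (Fintype.card M.Face + 2 * g) * (∏ e, Real.cosh (2 * J e)) *
        M.dimerZ₀ (M.aWeight J) (M.bWeight J) ∧
    ∀ P ∈ M.polygons 0,
      M.dIsingProbXOR rep J P = M.dimerProbPoly₁ (M.aWeight J) (M.bWeight J) P := by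
  have hZ : M.dIsingZ J = 2 ^ (Fintype.card M.Face + 2 * g) * (∏ e, Real.cosh (2 * J e)) *
      M.dimerZ₀ (M.aWeight J) (M.bWeight J) := by
    rw [SurfaceMap.dIsingZ_eq_sum_isXOR hrep, SurfaceMap.dimerZ₀_eq_sum, Finset.mul_sum]
    exact Finset.sum_congr rfl fun P hP => SurfaceMap.sum_dIsingWeight_isXOR_eq hg J hrep hP
  refine ⟨SurfaceMap.dIsingZ_eq_sum_sq J hrep, hZ, fun P hP => ?_⟩
  have hK : (2 : ℝ) ^ (Fintype.card M.Face + 2 * g) * ∏ e, Real.cosh (2 * J e) ≠ 0 :=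
    mul_ne_zero (pow_ne_zero _ two_ne_zero)
      (Finset.prod_ne_zero_iff.2 fun e _ => (Real.cosh_pos _).ne')
  rw [SurfaceMap.dIsingProbXOR, SurfaceMap.dimerProbPoly₁, ← Finset.sum_div, ← Finset.sum_div,
    SurfaceMap.sum_dIsingWeight_isXOR_eq hg J hrep hP, hZ, mul_div_mul_left _ _ hK]
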